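/- Let $D\subset\mathbb C$ be a simply connected domain (that is, open, connected and simply connected; no symmetry is assumed) with $D\neq\mathbb C$, and let $z_0\in D$. Put $$\delta_D(z_0):=\inf\{|z_0-w| : w\in\mathbb C\setminus D\},$$ and for $X\in\mathbb C$ define the hyperbolic metric $$\gamma_D(z_0;X):=\sup\left\{\frac{|F'(z_0)X|}{1-|F(z_0)|^2} : F\colon D\to\mathbb D \text{ holomorphic}\right\},$$ where $\mathbb D:=\{z\in\mathbb C:|z|<1\}$ is the open unit disk. Then $$\gamma_D(z_0;1)\ \ge\ \frac{1}{4\,\delta_D(z_0)}.$$ If $D$ is in addition convex, then $$\gamma_D(z_0;1)\ \ge\ \frac{1}{2\,\delta_D(z_0)}.$$ -/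

import Mathlib

/-- The hyperbolic (Carathéodory) metric of a domain `D ⊆ ℂ` at the point `z` in the direction `X`:
the supremum of `|F'(z) X| / (1 - |F(z)|²)` over all holomorphic functions `F` from `D` to the
open unit disk. (For open `D ∋ z` this set of reals is non-empty and bounded above.) -/
noncomputable def hyperbolicMetric (D : Set ℂ) (z X : ℂ) : ℝ :=
  sSup {r : ℝ | ∃ F : ℂ → ℂ, DifferentiableOn ℂ F D ∧ Set.MapsTo F D (Metric.ball (0 : ℂ) 1) ∧
    r = ‖deriv F z * X‖ / (1 - ‖F z‖ ^ 2)}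

/-- The distance `inf {|z - w| : w ∈ ℂ \ D}` from `z` to the complement of `D`. -/
noncomputable def distToCompl (D : Set ℂ) (z : ℂ) : ℝ :=
  sInf {r : ℝ | ∃ w : ℂ, w ∉ D ∧ r = ‖z - w‖}

open MeasureTheory Set Metric Filter
open scoped Topology ComplexConjugate

/-! Both bounds come from testing the supremum with maps `F` such that `F z₀ = 0`, where the
quotient is `‖deriv F z₀‖`; it suffices to bound this below in terms of `‖z₀ - w‖` for each `w`
outside `D`.

For convex `D`, separate `w` from `D` by a line and compose with the Cayley map of the resulting
half-plane.

In general, an almost-Riemann map suffices: for each `ρ < 1`, a univalent `F : D → 𝔻` with `F z₀ =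
0` whose image contains `ball 0 ρ`. If `‖deriv F z₀‖` is close enough to its supremum, an omitted
value of modulus below `ρ` would let Koebe's square root transformation exceed that supremum, so no
compactness argument is needed. Let `g` be the inverse of `F` and `s` a branch of `√(z - w)`. Since
`s` never takes two opposite values on `D`, the function `f = (s ∘ g - s z₀) / (s ∘ g + s z₀)` is
univalent on `ball 0 ρ` and satisfies `f u * f v ≠ 1`. The Bieberbach–Eilenberg inequality `‖deriv f
0‖ * ρ ≤ 1` then reads `ρ ≤ 4 * ‖deriv F z₀‖ * ‖z₀ - w‖`, and `ρ → 1` gives the constant 4.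

That inequality is an area estimate in the metric `|dw| / |w|`: the images of an annulus under `f`
and `1 / f` are disjoint, have equal area, and lie in a common annulus of known area. -/

/-! ### Logarithmic area and mean-square estimates -/

/-- Change of variables for an injective holomorphic map. -/
theorem lintegral_image_of_hasDerivAt {S : Set ℂ} (hS : MeasurableSet S) {h h' : ℂ → ℂ}
    (hd : ∀ z ∈ S, HasDerivAt h (h' z) z) (hinj : InjOn h S) (u : ℂ → ENNReal) :
    ∫⁻ w in h '' S, u w = ∫⁻ z in S, ENNReal.ofReal (‖h' z‖ ^ 2) * u (h z) := by
  rw [lintegral_image_eq_lintegral_abs_det_fderiv_mul volume hS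
    (fun z hz => ((hd z hz).hasFDerivAt.restrictScalars ℝ).hasFDerivWithinAt) hinj]
  refine setLIntegral_congr_fun hS fun z _ => ?_
  congr 2
  simp [ContinuousLinearMap.det, LinearMap.det_restrictScalars, Algebra.norm_complex_apply,
    Complex.normSq_eq_norm_sq]

/-- The area of a set in the metric `|dw| / |w|`. -/
noncomputable def logArea (S : Set ℂ) : ENNReal :=
  ∫⁻ w in S, ENNReal.ofReal ((‖w‖ ^ 2)⁻¹)

theorem logArea_image {S : Set ℂ} (hS : MeasurableSet S) {h h' : ℂ → ℂ}
    (hd : ∀ z ∈ S, HasDerivAt h (h' z) z) (hinj : InjOn h S) :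
    logArea (h '' S) = ∫⁻ z in S, ENNReal.ofReal (‖h' z / h z‖ ^ 2) := by
  rw [logArea, lintegral_image_of_hasDerivAt hS hd hinj]
  refine setLIntegral_congr_fun hS fun z _ => ?_
  rw [← ENNReal.ofReal_mul (by positivity), norm_div, div_pow, div_eq_mul_inv]

theorem MeasurableSet.reProdIm {s t : Set ℝ} (hs : MeasurableSet s) (ht : MeasurableSet t) :
    MeasurableSet (s ×ℂ t) :=
  (Complex.measurable_re hs).inter (Complex.measurable_im ht)

theorem lintegral_reProdIm {s t : Set ℝ} (hs : MeasurableSet s) (ht : MeasurableSet t)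
    {f : ℂ → ENNReal} (hf : AEMeasurable f (volume.restrict (s ×ℂ t))) :
    ∫⁻ z in s ×ℂ t, f z = ∫⁻ x in s, ∫⁻ y in t, f (x + y * Complex.I) := by
  have e := Complex.volume_preserving_equiv_real_prod.symm
  have hpre : Complex.measurableEquivRealProd.symm ⁻¹' (s ×ℂ t) = s ×ˢ t := by
    ext p; simp [Complex.mem_reProdIm, Complex.measurableEquivRealProd]
  have e' := e.restrict_preimage (hs.reProdIm ht)
  rw [hpre] at e'
  rw [← e'.lintegral_comp_emb (MeasurableEquiv.measurableEmbedding _), Measure.volume_eq_prod,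
    ← Measure.prod_restrict, lintegral_prod]
  · simp only [Complex.measurableEquivRealProd_symm_apply, Complex.mk_eq_add_mul_I]
  · rw [Measure.prod_restrict, ← Measure.volume_eq_prod]
    exact hf.comp_quasiMeasurePreserving e'.quasiMeasurePreserving

/-- In the coordinate `log w` the metric is Euclidean and the annulus becomes a rectangle of sides
`-2 log m` and `2π`. -/
theorem logArea_annulus_le {m : ℝ} (hm : 0 < m) :
    logArea {w : ℂ | m ≤ ‖w‖ ∧ ‖w‖ ≤ m⁻¹} ≤ ENNReal.ofReal (4 * Real.pi * -Real.log m) := by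
  set B : Set ℂ := Icc (Real.log m) (-Real.log m) ×ℂ Ioc (-Real.pi) Real.pi
  have hB : MeasurableSet B := measurableSet_Icc.reProdIm measurableSet_Ioc
  have hsub : {w : ℂ | m ≤ ‖w‖ ∧ ‖w‖ ≤ m⁻¹} ⊆ Complex.exp '' B := by
    rintro w ⟨h1, h2⟩
    have hw : w ≠ 0 := norm_pos_iff.1 (hm.trans_le h1)
    refine ⟨Complex.log w, ?_, Complex.exp_log hw⟩
    rw [Complex.mem_reProdIm, Complex.log_re, Complex.log_im, ← Real.log_inv]
    exact ⟨⟨Real.log_le_log hm h1, Real.log_le_log (hm.trans_le h1) h2⟩,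
      Complex.neg_pi_lt_arg w, Complex.arg_le_pi w⟩
  calc logArea _ ≤ logArea (Complex.exp '' B) := lintegral_mono_set hsub
    _ = ∫⁻ z in B, 1 := by
      rw [logArea_image hB (fun z _ => Complex.hasDerivAt_exp z)]
      · simp [Complex.exp_ne_zero]
      · intro x hx y hy hxy
        exact Complex.exp_inj_of_neg_pi_lt_of_le_pi hx.2.1 hx.2.2 hy.2.1 hy.2.2 hxy
    _ = ENNReal.ofReal (4 * Real.pi * -Real.log m) := by
      rw [lintegral_reProdIm measurableSet_Icc measurableSet_Ioc aemeasurable_const]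
      simp only [lintegral_const, one_mul, Measure.restrict_apply_univ, Real.volume_Ioc,
        Real.volume_Icc]
      rw [← ENNReal.ofReal_mul (by linarith [Real.pi_pos])]
      congr 1; ring

/-- A lower bound for the mean square of a holomorphic function with value `1` at the centre. -/
theorem two_pi_le_lintegral_circle {p : ℂ → ℂ} {R s : ℝ} (hp : DifferentiableOn ℂ p (ball 0 R))
    (hp0 : p 0 = 1) (hs : 0 < s) (hsR : s < R) :
    ENNReal.ofReal (2 * Real.pi) ≤
      ∫⁻ θ in Ioc (-Real.pi) Real.pi, ENNReal.ofReal (‖p (circleMap 0 s θ)‖ ^ 2) := by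
  have hcirc : ∀ θ, circleMap 0 s θ ∈ ball (0 : ℂ) R := fun θ => by simp [abs_of_pos hs, hsR]
  have hcont : Continuous fun θ => p (circleMap 0 s θ) :=
    continuous_iff_continuousAt.2 fun θ => ContinuousAt.comp
      (hp.differentiableAt (isOpen_ball.mem_nhds (hcirc θ))).continuousAt
      (continuous_circleMap 0 s).continuousAt
  have hre_cont : Continuous fun θ => (p (circleMap 0 s θ)).re := Complex.continuous_re.comp hcont
  have hnorm_cont : Continuous fun θ => ‖p (circleMap 0 s θ)‖ := hcont.norm
  have hmean : ∫ θ in (-Real.pi)..Real.pi, p (circleMap 0 s θ) = 2 * Real.pi := by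
    have h1 := circleAverage_of_differentiable_on_off_countable (f := p) (c := 0) (R := s)
      countable_empty
      (hp.continuousOn.mono (closedBall_subset_ball (by rwa [abs_of_pos hs])))
      (fun z hz => hp.differentiableAt (isOpen_ball.mem_nhds
        (ball_subset_ball (by rw [abs_of_pos hs]; exact hsR.le) hz.1)))
    rw [Real.circleAverage_def, hp0] at h1
    have hper : Function.Periodic (fun θ => p (circleMap 0 s θ)) (2 * Real.pi) := fun θ => by
      simp [periodic_circleMap 0 s θ]
    have h2 := hper.intervalIntegral_add_eq (-Real.pi) 0
    rw [show -Real.pi + 2 * Real.pi = Real.pi by ring, zero_add] at h2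
    rw [h2]
    have hpi : (2 * Real.pi : ℝ) ≠ 0 := by positivity
    rw [inv_smul_eq_iff₀ hpi] at h1
    simpa using h1
  -- The mean value property controls `p` only linearly; the pointwise bound `2 Re p - 1 ≤ ‖p‖²`
  -- turns this into a bound on the mean square.
  have hint : ∫ θ in (-Real.pi)..Real.pi, (2 * (p (circleMap 0 s θ)).re - 1) = 2 * Real.pi := by
    have hre : ∫ θ in (-Real.pi)..Real.pi, (p (circleMap 0 s θ)).re = 2 * Real.pi := by
      have := Complex.reCLM.intervalIntegral_comp_comm
        (hcont.intervalIntegrable (μ := volume) (-Real.pi) Real.pi)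
      simp only [Complex.reCLM_apply] at this
      rw [this, hmean]
      simp
    rw [intervalIntegral.integral_sub, intervalIntegral.integral_const_mul, hre,
      intervalIntegral.integral_const]
    · simp; ring
    · exact Continuous.intervalIntegrable (by fun_prop) _ _
    · simp
  have hle : ∫ θ in (-Real.pi)..Real.pi, (2 * (p (circleMap 0 s θ)).re - 1) ≤
      ∫ θ in (-Real.pi)..Real.pi, ‖p (circleMap 0 s θ)‖ ^ 2 := by
    refine intervalIntegral.integral_mono (by linarith [Real.pi_pos])
      (Continuous.intervalIntegrable (by fun_prop) _ _)
      (Continuous.intervalIntegrable (by fun_prop) _ _) fun θ => ?_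
    dsimp only
    rw [← Complex.normSq_eq_norm_sq, Complex.normSq_apply]
    nlinarith [sq_nonneg ((p (circleMap 0 s θ)).re - 1), sq_nonneg (p (circleMap 0 s θ)).im]
  rw [hint] at hle
  rw [intervalIntegral.integral_of_le (by linarith [Real.pi_pos])] at hle
  rw [← ofReal_integral_eq_lintegral_ofReal]
  · exact ENNReal.ofReal_le_ofReal hle
  · exact Continuous.integrableOn_Ioc (by fun_prop)
  · exact Filter.Eventually.of_forall fun θ => by positivity

/-- Each vertical segment of the box is mapped by `exp` onto a circle about `0`, so the circle bound
is integrated over the logarithm of the radius. -/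
theorem two_pi_log_le_lintegral_box {p : ℂ → ℂ} {R ρ r : ℝ} (hp : DifferentiableOn ℂ p (ball 0 R))
    (hp0 : p 0 = 1) (hρ : 0 < ρ) (hρr : ρ ≤ r) (hr : r < R) :
    ENNReal.ofReal (2 * Real.pi * (Real.log r - Real.log ρ)) ≤
      ∫⁻ z in Ioo (Real.log ρ) (Real.log r) ×ℂ Ioc (-Real.pi) Real.pi,
        ENNReal.ofReal (‖p (Complex.exp z)‖ ^ 2) := by
  have hlt : ∀ x ∈ Ioo (Real.log ρ) (Real.log r), Real.exp x < R := fun x hx =>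
    ((Real.lt_log_iff_exp_lt (hρ.trans_le hρr)).1 hx.2).trans hr
  rw [lintegral_reProdIm measurableSet_Ioo measurableSet_Ioc]
  · calc ENNReal.ofReal (2 * Real.pi * (Real.log r - Real.log ρ))
        = ∫⁻ x in Ioo (Real.log ρ) (Real.log r), ENNReal.ofReal (2 * Real.pi) := by
          rw [setLIntegral_const, Real.volume_Ioo, ENNReal.ofReal_mul (by positivity)]
      _ ≤ _ := by
          refine setLIntegral_mono' measurableSet_Ioo fun x hx => ?_
          refine (two_pi_le_lintegral_circle hp hp0 (Real.exp_pos x) (hlt x hx)).trans_eq ?_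
          simp [circleMap, Complex.exp_add]
  · refine ContinuousOn.aemeasurable ?_ (measurableSet_Ioo.reProdIm measurableSet_Ioc)
    refine ENNReal.continuous_ofReal.comp_continuousOn (ContinuousOn.pow (ContinuousOn.norm ?_) 2)
    refine hp.continuousOn.comp Complex.continuous_exp.continuousOn fun z hz => ?_
    simpa [Complex.norm_exp] using hlt _ hz.1

/-! ### The Bieberbach–Eilenberg inequality -/

/-- If a univalent map pushes the sphere of radius `ρ` out of the ball of radius `m`, then
it covers that ball. -/
theorem ball_subset_image_ball {f : ℂ → ℂ} {R ρ m : ℝ} (hf : DifferentiableOn ℂ f (ball 0 R))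
    (hinj : InjOn f (ball 0 R)) (hf0 : f 0 = 0) (hρ : 0 < ρ) (hρR : ρ < R)
    (hm : ∀ z : ℂ, ‖z‖ = ρ → m ≤ ‖f z‖) : ball 0 m ⊆ f '' ball 0 ρ := by
  rcases le_or_gt m 0 with hm0 | hm0
  · simp [ball_eq_empty.2 hm0]
  have hopen : IsOpen (f '' ball 0 ρ) := by
    have han : AnalyticOnNhd ℂ f (ball 0 R) := hf.analyticOnNhd isOpen_ball
    rcases han.is_constant_or_isOpen (convex_ball _ _).isPreconnected with ⟨w, hw⟩ | h
    · exfalso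
      have h1 : (0 : ℂ) ∈ ball (0 : ℂ) R := by simpa using hρ.trans hρR
      have h2 : ((ρ : ℝ) : ℂ) ∈ ball (0 : ℂ) R := by simpa [abs_of_pos hρ] using hρR
      have := hinj h1 h2 ((hw _ h1).trans (hw _ h2).symm)
      exact hρ.ne (by exact_mod_cast this)
    · exact h _ (ball_subset_ball hρR.le) isOpen_ball
  have hclosed : IsClosed (f '' closedBall 0 ρ) :=
    ((isCompact_closedBall _ _).image_of_continuousOn
      (hf.continuousOn.mono (closedBall_subset_ball hρR))).isClosed
  have hpre : IsPreconnected (ball (0 : ℂ) m) := (convex_ball _ _).isPreconnected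
  -- The connected ball avoids the image of the sphere, so it is split by two disjoint open sets:
  -- the image of the open ball and the complement of the image of the closed ball. It meets the
  -- first at `0`.
  refine hpre.subset_left_of_subset_union hopen hclosed.isOpen_compl ?_ ?_ ?_
  · exact disjoint_compl_right.mono_left (image_mono ball_subset_closedBall)
  · intro w hw
    by_cases h : w ∈ f '' closedBall 0 ρ
    · obtain ⟨z, hz, rfl⟩ := h
      refine Or.inl ⟨z, ?_, rfl⟩
      rw [mem_closedBall_zero_iff] at hz
      rw [mem_ball_zero_iff] at hw ⊢
      exact lt_of_le_of_ne hz fun h => (hm z h).not_gt hw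
    · exact Or.inr h
  · exact ⟨0, by simpa using hm0, 0, by simpa using hρ, hf0⟩

/-- The area inequality behind the Bieberbach–Eilenberg bound. -/
theorem mul_le_of_mul_ne_one {f : ℂ → ℂ} {R ρ r m : ℝ} (hf : DifferentiableOn ℂ f (ball 0 R))
    (hinj : InjOn f (ball 0 R)) (hf0 : f 0 = 0) (hf1 : deriv f 0 ≠ 0)
    (hne : ∀ z ∈ ball (0 : ℂ) R, ∀ w ∈ ball (0 : ℂ) R, f z * f w ≠ 1)
    (hρ : 0 < ρ) (hρr : ρ ≤ r) (hr : r < R) (hm0 : 0 < m)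
    (hm : ∀ z : ℂ, ‖z‖ = ρ → m ≤ ‖f z‖) : m * r ≤ ρ := by
  have hcov := ball_subset_image_ball hf hinj hf0 hρ (hρr.trans_lt hr) hm
  have h0R : (0 : ℂ) ∈ ball (0 : ℂ) R := by simpa using (hρ.trans_le hρr).trans hr
  have hRn : ball (0 : ℂ) R ∈ nhds 0 := isOpen_ball.mem_nhds h0R
  have hfne : ∀ z ∈ ball (0 : ℂ) R, z ≠ 0 → f z ≠ 0 := fun z hz hz0 h =>
    hz0 (hinj hz h0R (h.trans hf0.symm))
  have hge : ∀ z ∈ ball (0 : ℂ) R, ρ ≤ ‖z‖ → m ≤ ‖f z‖ := by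
    intro z hz hzρ
    by_contra! h
    obtain ⟨z', hz', he⟩ := hcov (mem_ball_zero_iff.2 h)
    rw [mem_ball_zero_iff] at hz'
    have := hinj (ball_subset_ball (hρr.trans hr.le) (mem_ball_zero_iff.2 hz')) hz he
    rw [this] at hz'
    exact hz'.not_ge hzρ
  -- A value larger than `m⁻¹` would have its reciprocal in the covered ball, giving two values with
  -- product `1`.
  have hle : ∀ z ∈ ball (0 : ℂ) R, ρ ≤ ‖z‖ → ‖f z‖ ≤ m⁻¹ := by
    intro z hz hzρ
    by_contra! h
    have hfz : f z ≠ 0 := norm_pos_iff.1 (hm0.trans_le (hge z hz hzρ))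
    have hmem : (f z)⁻¹ ∈ ball (0 : ℂ) m := by
      rw [mem_ball_zero_iff, norm_inv]
      exact inv_lt_of_inv_lt₀ hm0 h
    obtain ⟨z', hz', he⟩ := hcov hmem
    exact hne z hz z' (ball_subset_ball (hρr.trans hr.le) hz') (by rw [he, mul_inv_cancel₀ hfz])
  have hm1 : m ≤ 1 := by
    have hρz : ‖((ρ : ℝ) : ℂ)‖ = ρ := by simp [abs_of_pos hρ]
    have hρR : ((ρ : ℝ) : ℂ) ∈ ball (0 : ℂ) R := mem_ball_zero_iff.2 (by linarith)
    have h1 := (hge _ hρR hρz.ge).trans (hle _ hρR hρz.ge)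
    have h2 : m * m ≤ 1 := by
      calc m * m ≤ m * m⁻¹ := by gcongr
        _ = 1 := mul_inv_cancel₀ hm0.ne'
    nlinarith
  -- This is `z f'(z) / f(z)`, with the singularity at `0` removed by `dslope`.
  set p : ℂ → ℂ := fun z => deriv f z / dslope f 0 z with hp
  have hds : ∀ z, z ≠ 0 → dslope f 0 z = f z / z := fun z hz => by
    rw [dslope_of_ne _ hz, slope_def_field, hf0, sub_zero, sub_zero]
  have hpd : DifferentiableOn ℂ p (ball 0 R) := by
    refine (hf.deriv isOpen_ball).div ((Complex.differentiableOn_dslope hRn).2 hf) fun z hz => ?_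
    rcases eq_or_ne z 0 with rfl | h
    · rwa [dslope_same]
    · rw [hds z h]
      exact div_ne_zero (hfne z hz h) h
  have hp0 : p 0 = 1 := by simp [hp, hf1]
  set B : Set ℂ := Ioo (Real.log ρ) (Real.log r) ×ℂ Ioc (-Real.pi) Real.pi
  have hB : MeasurableSet B := measurableSet_Ioo.reProdIm measurableSet_Ioc
  have hBr : ∀ z ∈ B, Complex.exp z ∈ ball (0 : ℂ) R := fun z hz => by
    rw [mem_ball_zero_iff, Complex.norm_exp]
    exact ((Real.lt_log_iff_exp_lt (hρ.trans_le hρr)).1 hz.1.2).trans hr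
  have hBρ : ∀ z ∈ B, ρ ≤ ‖Complex.exp z‖ := fun z hz => by
    rw [Complex.norm_exp]
    exact ((Real.log_lt_iff_lt_exp hρ).1 hz.1.1).le
  have hexp : InjOn Complex.exp B := fun x hx y hy hxy =>
    Complex.exp_inj_of_neg_pi_lt_of_le_pi hx.2.1 hx.2.2 hy.2.1 hy.2.2 hxy
  have hhd : ∀ z ∈ B, HasDerivAt (fun z => f (Complex.exp z))
      (deriv f (Complex.exp z) * Complex.exp z) z := fun z hz =>
    ((hf.differentiableAt (isOpen_ball.mem_nhds (hBr z hz))).hasDerivAt).comp z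
      (Complex.hasDerivAt_exp z)
  have hhinj : InjOn (fun z => f (Complex.exp z)) B := fun x hx y hy hxy =>
    hexp hx hy (hinj (hBr x hx) (hBr y hy) hxy)
  have hhne : ∀ z ∈ B, f (Complex.exp z) ≠ 0 := fun z hz =>
    hfne _ (hBr z hz) (Complex.exp_ne_zero z)
  have hid : ∀ z ∈ B, ‖p (Complex.exp z)‖ =
      ‖deriv f (Complex.exp z) * Complex.exp z / f (Complex.exp z)‖ := fun z _ => by
    simp only [hp]
    rw [hds _ (Complex.exp_ne_zero z), div_div_eq_mul_div]
  have hlow := two_pi_log_le_lintegral_box hpd hp0 hρ hρr hr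
  have hA : ENNReal.ofReal (2 * Real.pi * (Real.log r - Real.log ρ)) ≤
      logArea ((fun z => f (Complex.exp z)) '' B) := by
    rw [logArea_image hB hhd hhinj]
    refine hlow.trans_eq (setLIntegral_congr_fun hB fun z hz => ?_)
    rw [hid z hz]
  -- Inversion only changes the sign of the logarithmic derivative, so the area bound is the same.
  have hA' : ENNReal.ofReal (2 * Real.pi * (Real.log r - Real.log ρ)) ≤
      logArea ((fun z => (f (Complex.exp z))⁻¹) '' B) := by
    rw [logArea_image hB (fun z hz => (hhd z hz).fun_inv (hhne z hz))
      (fun x hx y hy hxy => hhinj hx hy (inv_injective hxy))]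
    refine hlow.trans_eq (setLIntegral_congr_fun hB fun z hz => ?_)
    rw [hid z hz]
    congr 2
    rw [div_inv_eq_mul, div_mul_eq_mul_div, neg_mul, neg_div, norm_neg]
    have := hhne z hz
    congr 1
    field_simp
  have hmeas : MeasurableSet ((fun z => (f (Complex.exp z))⁻¹) '' B) :=
    hB.image_of_continuousOn_injOn
      (fun z hz => ((hhd z hz).fun_inv (hhne z hz)).continuousAt.continuousWithinAt)
      (fun x hx y hy hxy => hhinj hx hy (inv_injective hxy))
  have hdisj : Disjoint ((fun z => f (Complex.exp z)) '' B)
      ((fun z => (f (Complex.exp z))⁻¹) '' B) := by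
    rw [Set.disjoint_left]
    rintro _ ⟨z, hz, rfl⟩ ⟨z', hz', he⟩
    refine hne _ (hBr z hz) _ (hBr z' hz') ?_
    dsimp only at he
    rw [← he, inv_mul_cancel₀ (hhne z' hz')]
  have hsub : ((fun z => f (Complex.exp z)) '' B) ∪ ((fun z => (f (Complex.exp z))⁻¹) '' B) ⊆
      {w : ℂ | m ≤ ‖w‖ ∧ ‖w‖ ≤ m⁻¹} := by
    rintro _ (⟨z, hz, rfl⟩ | ⟨z, hz, rfl⟩)
    · exact ⟨hge _ (hBr z hz) (hBρ z hz), hle _ (hBr z hz) (hBρ z hz)⟩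
    · have h1 := hge _ (hBr z hz) (hBρ z hz)
      have h2 := hle _ (hBr z hz) (hBρ z hz)
      change _ ≤ ‖(f (Complex.exp z))⁻¹‖ ∧ ‖(f (Complex.exp z))⁻¹‖ ≤ _
      rw [norm_inv]
      exact ⟨le_inv_of_le_inv₀ (hm0.trans_le h1) h2, inv_anti₀ hm0 h1⟩
  have hfinal := (add_le_add hA hA').trans_eq (lintegral_union hmeas hdisj).symm
  have hfinal' := (hfinal.trans (lintegral_mono_set hsub)).trans (logArea_annulus_le hm0)
  have hlog : Real.log ρ ≤ Real.log r := Real.log_le_log hρ hρr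
  have hlogm : Real.log m ≤ 0 := Real.log_nonpos hm0.le hm1
  have hpi := Real.pi_pos
  have hnn : 0 ≤ 2 * Real.pi * (Real.log r - Real.log ρ) :=
    mul_nonneg (by positivity) (by linarith)
  rw [← ENNReal.ofReal_add hnn hnn, ENNReal.ofReal_le_ofReal_iff
    (mul_nonneg (by positivity) (by linarith))] at hfinal'
  have h3 : Real.log r - Real.log ρ ≤ - Real.log m :=
    le_of_mul_le_mul_left (by linarith) (by positivity : 0 < 4 * Real.pi)
  have hr0 := hρ.trans_le hρr
  rw [← Real.log_le_log_iff (by positivity) hρ, Real.log_mul hm0.ne' hr0.ne']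
  linarith

/-- The Bieberbach–Eilenberg inequality for univalent functions. -/
theorem norm_deriv_mul_le_one_of_mul_ne_one {f : ℂ → ℂ} {R : ℝ} (hR : 0 < R)
    (hf : DifferentiableOn ℂ f (ball 0 R)) (hinj : InjOn f (ball 0 R)) (hf0 : f 0 = 0)
    (hne : ∀ z ∈ ball (0 : ℂ) R, ∀ w ∈ ball (0 : ℂ) R, f z * f w ≠ 1) :
    ‖deriv f 0‖ * R ≤ 1 := by
  by_cases hf1 : deriv f 0 = 0
  · simp [hf1]
  have hd0 : 0 < ‖deriv f 0‖ := norm_pos_iff.2 hf1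
  have hder : HasDerivAt f (deriv f 0) 0 :=
    (hf.differentiableAt (isOpen_ball.mem_nhds (by simpa using hR))).hasDerivAt
  have key : ∀ c r, 0 < c → c < ‖deriv f 0‖ → 0 < r → r < R → c * r ≤ 1 := by
    intro c r hc hcd hr0 hr
    have hlim := hder.tendsto_slope.norm.eventually (lt_mem_nhds hcd)
    rw [eventually_nhdsWithin_iff, Metric.eventually_nhds_iff] at hlim
    obtain ⟨ε, hε, h⟩ := hlim
    -- On such a small circle `‖f z‖ > c * ‖z‖`, so `m = c * ρ` is admissible and `ρ` cancels from
    -- `m * r ≤ ρ`.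
    have hρ : 0 < min r (ε / 2) := lt_min hr0 (by positivity)
    have := mul_le_of_mul_ne_one hf hinj hf0 hf1 hne hρ (min_le_left _ _) hr
      (m := c * min r (ε / 2)) (by positivity) (fun z hz => by
        have hz0 : z ≠ 0 := norm_pos_iff.1 (hz ▸ hρ)
        have h1 := h (y := z) (by
          rw [dist_zero_right, hz]; linarith [min_le_right r (ε / 2)]) hz0
        rw [slope_def_field, hf0, sub_zero, sub_zero, norm_div, hz, lt_div_iff₀ hρ] at h1
        exact h1.le)
    rw [mul_right_comm] at this
    exact le_of_mul_le_mul_right (by linarith) hρ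
  have h1 : ∀ c, 0 < c → c < ‖deriv f 0‖ → c * R ≤ 1 := fun c hc hcd => by
    rw [← le_div_iff₀' hc]
    refine le_of_forall_lt_imp_le_of_dense fun r hr => ?_
    rcases le_or_gt r 0 with h | h
    · exact h.trans (by positivity)
    · rw [le_div_iff₀' hc]; exact key c r hc hcd h hr
  rw [← le_div_iff₀ hR]
  refine le_of_forall_lt_imp_le_of_dense fun c hc => ?_
  rcases le_or_gt c 0 with h | h
  · exact h.trans (by positivity)
  · rw [le_div_iff₀ hR]; exact h1 c h hc

/-! ### Disk automorphisms and holomorphic square roots -/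

/-- The automorphism of the unit disk taking `a` to `0`. -/
noncomputable def diskAut (a z : ℂ) : ℂ := (z - a) / (1 - conj a * z)

section DiskAut

variable {a z : ℂ}

theorem one_sub_conj_mul_ne_zero (ha : ‖a‖ < 1) (hz : ‖z‖ < 1) : 1 - conj a * z ≠ 0 := by
  intro h
  have h1 : ‖conj a * z‖ = 1 := by rw [← sub_eq_zero.1 h, norm_one]
  rw [norm_mul, RCLike.norm_conj] at h1
  nlinarith [norm_nonneg a, norm_nonneg z]

theorem diskAut_self : diskAut a a = 0 := by simp [diskAut]

theorem norm_diskAut_lt_one (ha : ‖a‖ < 1) (hz : ‖z‖ < 1) : ‖diskAut a z‖ < 1 := by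
  have h := one_sub_conj_mul_ne_zero ha hz
  rw [diskAut, norm_div, div_lt_one (norm_pos_iff.2 h)]
  refine lt_of_pow_lt_pow_left₀ 2 (norm_nonneg _) ?_
  have ha2 : ‖a‖ ^ 2 < 1 := by nlinarith [norm_nonneg a]
  have hz2 : ‖z‖ ^ 2 < 1 := by nlinarith [norm_nonneg z]
  have key : ‖1 - conj a * z‖ ^ 2 - ‖z - a‖ ^ 2 = (1 - ‖a‖ ^ 2) * (1 - ‖z‖ ^ 2) := by
    simp only [← Complex.normSq_eq_norm_sq, Complex.normSq_apply]
    simp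
    ring
  nlinarith [mul_pos (sub_pos.2 ha2) (sub_pos.2 hz2)]

theorem diskAut_injOn (ha : ‖a‖ < 1) : InjOn (diskAut a) (ball 0 1) := by
  intro z hz w hw h
  rw [mem_ball_zero_iff] at hz hw
  rw [diskAut, diskAut, div_eq_div_iff (one_sub_conj_mul_ne_zero ha hz)
    (one_sub_conj_mul_ne_zero ha hw)] at h
  have h1 : (z - w) * (1 - conj a * a) = 0 := by linear_combination h
  exact sub_eq_zero.1 ((mul_eq_zero.1 h1).resolve_right (one_sub_conj_mul_ne_zero ha ha))

theorem hasDerivAt_diskAut (ha : ‖a‖ < 1) (hz : ‖z‖ < 1) :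
    HasDerivAt (diskAut a) ((1 - conj a * a) / (1 - conj a * z) ^ 2) z := by
  have h := one_sub_conj_mul_ne_zero ha hz
  have := ((hasDerivAt_id z).sub_const a).fun_div
    (((hasDerivAt_id z).const_mul (conj a)).const_sub 1) h
  refine this.congr_deriv ?_
  simp only [id_eq]
  ring

theorem diskAut_ne_zero (ha : ‖a‖ < 1) (hz : ‖z‖ < 1) (h : z ≠ a) : diskAut a z ≠ 0 :=
  div_ne_zero (sub_ne_zero.2 h) (one_sub_conj_mul_ne_zero ha hz)

end DiskAut

/-- A continuous square root of a differentiable function is differentiable. -/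
theorem HasDerivAt.of_sq_eq {f g : ℂ → ℂ} {g' z : ℂ} (hg : HasDerivAt g g' z)
    (hf : ContinuousAt f z) (hz : f z ≠ 0) (h : ∀ x, f x ^ 2 = g x) :
    HasDerivAt f (g' / (2 * f z)) z := by
  rw [hasDerivAt_iff_tendsto_slope] at hg ⊢
  have hlim : Tendsto (fun y => f y + f z) (𝓝[≠] z) (𝓝 (2 * f z)) := by
    rw [two_mul]
    exact (hf.tendsto.mono_left nhdsWithin_le_nhds).add_const _
  have hne : 2 * f z ≠ 0 := mul_ne_zero two_ne_zero hz
  refine (hg.div hlim hne).congr' ?_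
  filter_upwards [hlim.eventually_ne hne] with y hy
  simp only [Pi.div_apply, slope_def_field, ← h]
  rw [div_div, mul_comm, ← div_div, sq_sub_sq, mul_div_cancel_left₀ _ hy]

/-- A holomorphic square root of `z - w` on a simply connected domain omitting `w`. -/
theorem exists_sqrt_sub {D : Set ℂ} (hDo : IsOpen D) (hDs : IsSimplyConnected D) {w : ℂ}
    (hw : w ∉ D) : ∃ s : ℂ → ℂ, (∀ z, s z ^ 2 = z - w) ∧
      ∀ z ∈ D, s z ≠ 0 ∧ HasDerivAt s (1 / (2 * s z)) z := by
  obtain ⟨s, hsc, hs⟩ := Complex.exists_continuousOn_pow_eq hDs hDo (g := fun z => z - w)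
    (by fun_prop) (by rintro ⟨z, hz, h⟩; exact hw (sub_eq_zero.1 h ▸ hz)) two_ne_zero
  refine ⟨s, hs, fun z hz => ?_⟩
  have hne : s z ≠ 0 := fun h => by
    have := hs z
    rw [h, zero_pow two_ne_zero, eq_comm, sub_eq_zero] at this
    exact hw (this ▸ hz)
  exact ⟨hne, ((hasDerivAt_id z).sub_const w).of_sq_eq (hsc.continuousAt (hDo.mem_nhds hz)) hne hs⟩

/-! ### Almost-Riemann maps by Koebe's method -/

/-- Univalent maps to the unit disk, with nonvanishing derivative. -/
structure UnivalentToDisk (D : Set ℂ) (F : ℂ → ℂ) : Prop where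
  mapsTo : ∀ z ∈ D, ‖F z‖ < 1
  injOn : InjOn F D
  differentiableAt : ∀ z ∈ D, DifferentiableAt ℂ F z
  deriv_ne_zero : ∀ z ∈ D, deriv F z ≠ 0

namespace UnivalentToDisk

variable {D : Set ℂ} {F : ℂ → ℂ} {z₀ : ℂ}

theorem hasDerivAt_diskAut_comp {a z : ℂ} (hF : UnivalentToDisk D F) (ha : ‖a‖ < 1) (hz : z ∈ D) :
    HasDerivAt (fun z => diskAut a (F z))
      ((1 - conj a * a) / (1 - conj a * F z) ^ 2 * deriv F z) z :=
  (hasDerivAt_diskAut ha (hF.mapsTo z hz)).comp z (hF.differentiableAt z hz).hasDerivAt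

theorem diskAut_comp {a : ℂ} (hF : UnivalentToDisk D F) (ha : ‖a‖ < 1) :
    UnivalentToDisk D (fun z => diskAut a (F z)) where
  mapsTo z hz := norm_diskAut_lt_one ha (hF.mapsTo z hz)
  injOn x hx y hy h := hF.injOn hx hy (diskAut_injOn ha (by simpa using hF.mapsTo x hx)
    (by simpa using hF.mapsTo y hy) h)
  differentiableAt z hz := (hF.hasDerivAt_diskAut_comp ha hz).differentiableAt
  deriv_ne_zero z hz := by
    rw [(hF.hasDerivAt_diskAut_comp ha hz).deriv]
    exact mul_ne_zero (div_ne_zero (one_sub_conj_mul_ne_zero ha ha)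
      (pow_ne_zero 2 (one_sub_conj_mul_ne_zero ha (hF.mapsTo z hz)))) (hF.deriv_ne_zero z hz)

theorem norm_deriv_diskAut_comp_self (hF : UnivalentToDisk D F) (hz : z₀ ∈ D) :
    ‖deriv (fun z => diskAut (F z₀) (F z)) z₀‖ = ‖deriv F z₀‖ / (1 - ‖F z₀‖ ^ 2) := by
  have hlt := hF.mapsTo z₀ hz
  have h1 : 0 < 1 - ‖F z₀‖ ^ 2 := by nlinarith [norm_nonneg (F z₀)]
  have h2 : (1 - conj (F z₀) * F z₀ : ℂ) = ((1 - ‖F z₀‖ ^ 2 : ℝ) : ℂ) := by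
    rw [Complex.conj_mul']; push_cast; rfl
  rw [(hF.hasDerivAt_diskAut_comp hlt hz).deriv, norm_mul, h2, norm_div, norm_pow,
    Complex.norm_of_nonneg h1.le]
  field_simp

/-- The square root of a zero-free univalent map. -/
theorem exists_sqrt (hDo : IsOpen D) (hDs : IsSimplyConnected D) (hF : UnivalentToDisk D F)
    (h0 : ∀ z ∈ D, F z ≠ 0) : ∃ q, UnivalentToDisk D q ∧ (∀ z, q z ^ 2 = F z) ∧
      ∀ z ∈ D, deriv q z = deriv F z / (2 * q z) := by
  obtain ⟨q, hqc, hq⟩ := Complex.exists_continuousOn_pow_eq hDs hDo (g := F)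
    (fun z hz => (hF.differentiableAt z hz).continuousAt.continuousWithinAt)
    (by rintro ⟨z, hz, h⟩; exact h0 z hz h) two_ne_zero
  have hne : ∀ z ∈ D, q z ≠ 0 := fun z hz h => h0 z hz (by rw [← hq, h, zero_pow two_ne_zero])
  have hd : ∀ z ∈ D, HasDerivAt q (deriv F z / (2 * q z)) z := fun z hz =>
    (hF.differentiableAt z hz).hasDerivAt.of_sq_eq (hqc.continuousAt (hDo.mem_nhds hz))
      (hne z hz) hq
  refine ⟨q, ⟨fun z hz => ?_, fun x hx y hy h => ?_, fun z hz => (hd z hz).differentiableAt,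
    fun z hz => ?_⟩, hq, fun z hz => (hd z hz).deriv⟩
  · have := hF.mapsTo z hz
    rw [← hq, norm_pow] at this
    exact (pow_lt_one_iff_of_nonneg (norm_nonneg _) two_ne_zero).1 this
  · exact hF.injOn hx hy (by rw [← hq, ← hq, h])
  · rw [(hd z hz).deriv]
    exact div_ne_zero (hF.deriv_ne_zero z hz) (mul_ne_zero two_ne_zero (hne z hz))

/-- Koebe's square root transformation increases the derivative at the base point. -/
theorem exists_koebe_step (hDo : IsOpen D) (hDs : IsSimplyConnected D) (hz₀ : z₀ ∈ D)
    (hF : UnivalentToDisk D F) (hF0 : F z₀ = 0) {a : ℂ} (ha : ‖a‖ < 1) (haF : a ∉ F '' D) :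
    ∃ G, UnivalentToDisk D G ∧ G z₀ = 0 ∧
      (1 + (1 - √‖a‖) ^ 2 / 2) * ‖deriv F z₀‖ ≤ ‖deriv G z₀‖ := by
  have ha0 : a ≠ 0 := fun h => haF ⟨z₀, hz₀, hF0.trans h.symm⟩
  obtain ⟨q, hq, hqq, hqd⟩ := (hF.diskAut_comp ha).exists_sqrt hDo hDs fun z hz =>
    diskAut_ne_zero ha (hF.mapsTo z hz) fun h => haF ⟨z, hz, h⟩
  refine ⟨fun z => diskAut (q z₀) (q z), hq.diskAut_comp (hq.mapsTo z₀ hz₀), diskAut_self, ?_⟩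
  have hq0 : ‖q z₀‖ ^ 2 = ‖a‖ := by
    rw [← norm_pow, hqq, hF0]
    simp [diskAut]
  have hq1 := hq.mapsTo z₀ hz₀
  have hb : √‖a‖ = ‖q z₀‖ := by rw [← hq0, Real.sqrt_sq (norm_nonneg _)]
  have hqpos : 0 < ‖q z₀‖ := by rw [← hb]; exact Real.sqrt_pos.2 (norm_pos_iff.2 ha0)
  have haa : ‖1 - conj a * a‖ = 1 - ‖a‖ ^ 2 := by
    have : (1 - conj a * a : ℂ) = ((1 - ‖a‖ ^ 2 : ℝ) : ℂ) := by
      rw [Complex.conj_mul']; push_cast; rfl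
    rw [this, Complex.norm_of_nonneg (by nlinarith [norm_nonneg a])]
  rw [hq.norm_deriv_diskAut_comp_self hz₀, hqd z₀ hz₀, (hF.hasDerivAt_diskAut_comp ha hz₀).deriv,
    hF0, hb, norm_div, norm_mul, norm_mul, norm_div, haa, ← hq0]
  simp only [mul_zero, sub_zero, one_pow, norm_one, div_one, Complex.norm_ofNat]
  generalize ‖q z₀‖ = b at *
  have h1 : 0 < 1 - b ^ 2 := by nlinarith
  have h2 : (1 - (b ^ 2) ^ 2) * ‖deriv F z₀‖ / (2 * b) / (1 - b ^ 2) =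
      ((1 + b ^ 2) / (2 * b)) * ‖deriv F z₀‖ := by
    field_simp
    ring
  rw [h2]
  -- The exact gain is `(1 + b²) / (2b) = 1 + (1 - b)² / (2b)` with `b = √‖a‖ < 1`; dropping `b`
  -- from the denominator makes the bound monotone in `‖a‖`.
  refine mul_le_mul_of_nonneg_right ?_ (norm_nonneg _)
  rw [le_div_iff₀ (by positivity)]
  nlinarith [mul_nonneg (sq_nonneg (1 - b)) (sub_nonneg.2 hq1.le)]

/-- A proper simply connected domain carries a univalent map to the disk. -/
theorem exists_of_isSimplyConnected (hDo : IsOpen D) (hDs : IsSimplyConnected D) (hz₀ : z₀ ∈ D)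
    {w : ℂ} (hw : w ∉ D) : ∃ F, UnivalentToDisk D F := by
  obtain ⟨s, hs, hsD⟩ := exists_sqrt_sub hDo hDs hw
  have hinj : ∀ x y, s x ^ 2 = s y ^ 2 → x = y := fun x y h => by
    simpa [hs] using h
  have himg : s '' D ∈ 𝓝 (s z₀) := by
    have han : AnalyticAt ℂ s z₀ := DifferentiableOn.analyticAt
      (fun z hz => (hsD z hz).2.differentiableAt.differentiableWithinAt) (hDo.mem_nhds hz₀)
    have hstr := han.hasStrictDerivAt
    rw [(hsD z₀ hz₀).2.deriv] at hstr
    rw [← hstr.map_nhds_eq (by simpa using (hsD z₀ hz₀).1)]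
    exact image_mem_map (hDo.mem_nhds hz₀)
  obtain ⟨ε, hε, hball⟩ := Metric.mem_nhds_iff.1 himg
  -- The image of `s` contains a ball about `s z₀`, hence misses the opposite ball about `-s z₀`;
  -- inverting about that centre gives a bounded map.
  have hfar : ∀ z ∈ D, ε ≤ ‖s z + s z₀‖ := by
    intro z hz
    by_contra! h
    obtain ⟨y, hy, hyz⟩ := hball (show -s z ∈ ball (s z₀) ε by
      rw [mem_ball, dist_eq_norm, ← norm_neg,
        show -(-s z - s z₀) = s z + s z₀ by ring]
      exact h)
    have : y = z := hinj y z (by rw [hyz]; ring)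
    subst this
    exact (hsD y hy).1 (by linear_combination hyz / 2)
  have hne : ∀ z ∈ D, s z + s z₀ ≠ 0 := fun z hz => norm_pos_iff.1 (hε.trans_le (hfar z hz))
  have hε2 : ((ε / 2 : ℝ) : ℂ) ≠ 0 := by exact_mod_cast (half_pos hε).ne'
  have hd : ∀ z ∈ D, HasDerivAt (fun z => ((ε / 2 : ℝ) : ℂ) / (s z + s z₀))
      (-(((ε / 2 : ℝ) : ℂ) * (1 / (2 * s z))) / (s z + s z₀) ^ 2) z := fun z hz => by
    simpa using (hasDerivAt_const z ((ε / 2 : ℝ) : ℂ)).fun_div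
      ((hsD z hz).2.add_const (s z₀)) (hne z hz)
  refine ⟨_, fun z hz => ?_, fun x hx y hy h => ?_, fun z hz => (hd z hz).differentiableAt,
    fun z hz => ?_⟩
  · rw [norm_div, Complex.norm_of_nonneg (half_pos hε).le, div_lt_one (hε.trans_le (hfar z hz))]
    linarith [hfar z hz]
  · rw [div_eq_div_iff (hne x hx) (hne y hy)] at h
    have := mul_left_cancel₀ hε2 h
    exact hinj x y (by rw [add_right_cancel this])
  · rw [(hd z hz).deriv]
    exact div_ne_zero (neg_ne_zero.2 (mul_ne_zero hε2 (one_div_ne_zero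
      (mul_ne_zero two_ne_zero (hsD z hz).1)))) (pow_ne_zero 2 (hne z hz))

end UnivalentToDisk

/-- Univalent maps to the disk whose image contains a disk of radius close to `1`. -/
theorem exists_univalentToDisk_ball_subset {D : Set ℂ} {z₀ : ℂ} (hDo : IsOpen D)
    (hDs : IsSimplyConnected D) (hz₀ : z₀ ∈ D) (hD : D ≠ univ) {ρ : ℝ} (hρ : ρ < 1) :
    ∃ F, UnivalentToDisk D F ∧ F z₀ = 0 ∧ ball 0 ρ ⊆ F '' D := by
  obtain ⟨w, hw⟩ := (ne_univ_iff_exists_notMem D).1 hD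
  obtain ⟨F₀, hF₀⟩ := UnivalentToDisk.exists_of_isSimplyConnected hDo hDs hz₀ hw
  set A : Set ℝ := {x | ∃ F, UnivalentToDisk D F ∧ F z₀ = 0 ∧ x = ‖deriv F z₀‖} with hA
  obtain ⟨d, hd, hdD⟩ := Metric.isOpen_iff.1 hDo z₀ hz₀
  have hbdd : BddAbove A := by
    refine ⟨1 / d, ?_⟩
    rintro _ ⟨F, hF, hF0, rfl⟩
    refine Complex.norm_deriv_le_div_of_mapsTo_ball
      (fun z hz => (hF.differentiableAt z (hdD hz)).differentiableWithinAt) ?_ hd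
    intro z hz
    rw [hF0]
    simpa using (hF.mapsTo z (hdD hz)).le
  have hmem : ‖deriv (fun z => diskAut (F₀ z₀) (F₀ z)) z₀‖ ∈ A :=
    ⟨_, hF₀.diskAut_comp (hF₀.mapsTo z₀ hz₀), diskAut_self, rfl⟩
  have hpos : 0 < sSup A := (norm_pos_iff.2
    ((hF₀.diskAut_comp (hF₀.mapsTo z₀ hz₀)).deriv_ne_zero z₀ hz₀)).trans_le (le_csSup hbdd hmem)
  have hsq : √ρ < 1 := by
    rw [Real.sqrt_lt' one_pos, one_pow]; exact hρ
  set K : ℝ := 1 + (1 - √ρ) ^ 2 / 2 with hK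
  have hK1 : 1 < K := by have := sub_pos.2 hsq; simp only [hK]; linarith [pow_pos this 2]
  -- `F` is within a factor `K` of the supremum, while omitting a value of modulus below `ρ` allows
  -- a gain of at least `K`.
  obtain ⟨_, ⟨F, hF, hF0, rfl⟩, hlt⟩ := exists_lt_of_lt_csSup ⟨_, hmem⟩ (div_lt_self hpos hK1)
  refine ⟨F, hF, hF0, fun a ha => ?_⟩
  by_contra haF
  rw [mem_ball_zero_iff] at ha
  obtain ⟨G, hG, hG0, hle⟩ := hF.exists_koebe_step hDo hDs hz₀ hF0 (ha.trans hρ) haF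
  have hKle : K ≤ 1 + (1 - √‖a‖) ^ 2 / 2 := by
    have h1 : √‖a‖ ≤ √ρ := Real.sqrt_le_sqrt ha.le
    have h2 := pow_le_pow_left₀ (sub_nonneg.2 hsq.le) (sub_le_sub_left h1 1) 2
    simp only [hK]; linarith
  have h3 : sSup A < K * ‖deriv F z₀‖ := by
    rwa [div_lt_iff₀' (by linarith)] at hlt
  have h4 := mul_le_mul_of_nonneg_right hKle (norm_nonneg (deriv F z₀))
  exact (le_csSup hbdd ⟨G, hG, hG0, rfl⟩).not_gt (h3.trans_le (h4.trans hle))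

/-! ### The Koebe quarter bound -/

/-- The inverse of a univalent map is holomorphic. -/
theorem UnivalentToDisk.exists_inverse {D : Set ℂ} {F : ℂ → ℂ} (hDo : IsOpen D)
    (hF : UnivalentToDisk D F) :
    ∃ g : ℂ → ℂ, (∀ z ∈ D, g (F z) = z) ∧
      ∀ z ∈ D, HasDerivAt g (deriv F z)⁻¹ (F z) := by
  have hg : ∀ z ∈ D, Function.invFunOn F D (F z) = z := hF.injOn.leftInvOn_invFunOn
  refine ⟨Function.invFunOn F D, hg, fun z hz => ?_⟩
  have hmap : map F (𝓝 z) = 𝓝 (F z) := by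
    have han : AnalyticAt ℂ F z := DifferentiableOn.analyticAt
      (fun y hy => (hF.differentiableAt y hy).differentiableWithinAt) (hDo.mem_nhds hz)
    exact han.hasStrictDerivAt.map_nhds_eq (hF.deriv_ne_zero z hz)
  refine HasDerivAt.of_local_left_inverse (f := F) ?_ ?_ (hF.deriv_ne_zero z hz) ?_
  · rw [ContinuousAt, hg z hz, ← hmap, tendsto_map'_iff]
    refine tendsto_id.congr' ?_
    filter_upwards [hDo.mem_nhds hz] with y hy using (hg y hy).symm
  · rw [hg z hz]
    exact (hF.differentiableAt z hz).hasDerivAt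
  · rw [← hmap, eventually_map]
    filter_upwards [hDo.mem_nhds hz] with y hy
    rw [hg y hy]

/-- The Koebe quarter bound, for a univalent map to the disk covering a disk of radius `ρ`. -/
theorem UnivalentToDisk.radius_le {D : Set ℂ} {F : ℂ → ℂ} {z₀ w : ℂ} {ρ : ℝ} (hDo : IsOpen D)
    (hDs : IsSimplyConnected D) (hz₀ : z₀ ∈ D) (hF : UnivalentToDisk D F) (hF0 : F z₀ = 0)
    (hρ : 0 < ρ) (hcov : ball 0 ρ ⊆ F '' D) (hw : w ∉ D) :
    ρ ≤ 4 * ‖deriv F z₀‖ * ‖z₀ - w‖ := by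
  obtain ⟨g, hgF, hgd⟩ := hF.exists_inverse hDo
  obtain ⟨s, hs, hsD⟩ := exists_sqrt_sub hDo hDs hw
  have hsinj : ∀ x y, s x ^ 2 = s y ^ 2 → x = y := fun x y h => by simpa [hs] using h
  have ha : s z₀ ≠ 0 := (hsD z₀ hz₀).1
  have hne : ∀ x ∈ D, ∀ y ∈ D, s x + s y ≠ 0 := by
    intro x hx y hy h
    have hxy : x = y := hsinj x y (by linear_combination (s x - s y) * h)
    subst hxy
    exact (hsD x hx).1 (by linear_combination h / 2)
  set f : ℂ → ℂ := fun u => (s (g u) - s z₀) / (s (g u) + s z₀) with hfdef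
  have hder : ∀ z ∈ D, HasDerivAt f ((1 / (2 * s z) * (deriv F z)⁻¹ * (s z + s z₀) -
      (s z - s z₀) * (1 / (2 * s z) * (deriv F z)⁻¹)) / (s z + s z₀) ^ 2) (F z) := by
    intro z hz
    have h1 : HasDerivAt (fun u => s (g u)) (1 / (2 * s z) * (deriv F z)⁻¹) (F z) := by
      refine HasDerivAt.comp (F z) ?_ (hgd z hz)
      rw [hgF z hz]
      exact (hsD z hz).2
    have h2 := (h1.sub_const (s z₀)).fun_div (h1.add_const (s z₀))
      (by rw [hgF z hz]; exact hne z hz z₀ hz₀)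
    rwa [hgF z hz] at h2
  have hfd : DifferentiableOn ℂ f (ball 0 ρ) := by
    intro u hu
    obtain ⟨z, hz, rfl⟩ := hcov hu
    exact (hder z hz).differentiableAt.differentiableWithinAt
  have hinj : InjOn f (ball 0 ρ) := by
    intro u hu v hv h
    obtain ⟨x, hx, rfl⟩ := hcov hu
    obtain ⟨y, hy, rfl⟩ := hcov hv
    simp only [hfdef] at h
    rw [hgF x hx, hgF y hy, div_eq_div_iff (hne x hx z₀ hz₀) (hne y hy z₀ hz₀)] at h
    have h1 : s x = s y := mul_left_cancel₀ (mul_ne_zero two_ne_zero ha) (by linear_combination h)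
    rw [hsinj x y (by rw [h1])]
  have hf0 : f 0 = 0 := by
    have h0 := hgF z₀ hz₀
    rw [hF0] at h0
    simp [hfdef, h0]
  have hprod : ∀ u ∈ ball (0 : ℂ) ρ, ∀ v ∈ ball (0 : ℂ) ρ, f u * f v ≠ 1 := by
    intro u hu v hv h
    obtain ⟨x, hx, rfl⟩ := hcov hu
    obtain ⟨y, hy, rfl⟩ := hcov hv
    simp only [hfdef] at h
    rw [hgF x hx, hgF y hy, div_mul_div_comm,
      div_eq_one_iff_eq (mul_ne_zero (hne x hx z₀ hz₀) (hne y hy z₀ hz₀))] at h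
    have h1 : 2 * s z₀ * (s x + s y) = 0 := by linear_combination -h
    exact mul_ne_zero (mul_ne_zero two_ne_zero ha) (hne x hx y hy) h1
  have hF' : 0 < ‖deriv F z₀‖ := norm_pos_iff.2 (hF.deriv_ne_zero z₀ hz₀)
  have hmain := norm_deriv_mul_le_one_of_mul_ne_one hρ hfd hinj hf0 hprod
  have hd0 := hder z₀ hz₀
  rw [hF0] at hd0
  have hval : deriv f 0 = (4 * deriv F z₀ * (z₀ - w))⁻¹ := by
    have hFne := hF.deriv_ne_zero z₀ hz₀
    rw [hd0.deriv, ← hs]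
    field_simp
    ring
  have hzw : 0 < ‖z₀ - w‖ := norm_pos_iff.2 (sub_ne_zero.2 fun h => hw (h ▸ hz₀))
  rw [hval, norm_inv, norm_mul, norm_mul, Complex.norm_ofNat, inv_mul_le_iff₀ (by positivity),
    mul_one] at hmain
  exact hmain

/-! ### Lower bounds for the hyperbolic metric -/

/-- Moving `F z` to `0` by a disk automorphism turns the quotient into a derivative, which the
Schwarz lemma bounds on a disk inside `D`. Boundedness is needed for `sSup` to dominate its members.
-/
theorem bddAbove_hyperbolicMetric {D : Set ℂ} (hDo : IsOpen D) {z : ℂ} (hz : z ∈ D) :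
    BddAbove {r : ℝ | ∃ F : ℂ → ℂ, DifferentiableOn ℂ F D ∧
      Set.MapsTo F D (Metric.ball (0 : ℂ) 1) ∧ r = ‖deriv F z * 1‖ / (1 - ‖F z‖ ^ 2)} := by
  obtain ⟨d, hd, hdD⟩ := Metric.isOpen_iff.1 hDo z hz
  refine ⟨1 / d, ?_⟩
  rintro _ ⟨F, hF, hmaps, rfl⟩
  have hlt : ∀ y ∈ D, ‖F y‖ < 1 := fun y hy => by simpa using hmaps hy
  have hFz := hlt z hz
  have hG : ∀ y ∈ D, HasDerivAt (fun y => diskAut (F z) (F y))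
      ((1 - conj (F z) * F z) / (1 - conj (F z) * F y) ^ 2 * deriv F y) y := fun y hy =>
    (hasDerivAt_diskAut hFz (hlt y hy)).comp y (hF.differentiableAt (hDo.mem_nhds hy)).hasDerivAt
  have h1 : 0 < 1 - ‖F z‖ ^ 2 := by nlinarith [norm_nonneg (F z)]
  have h2 : (1 - conj (F z) * F z : ℂ) = ((1 - ‖F z‖ ^ 2 : ℝ) : ℂ) := by
    rw [Complex.conj_mul']; push_cast; rfl
  have hle := Complex.norm_deriv_le_div_of_mapsTo_ball (f := fun y => diskAut (F z) (F y))
    (c := z) (R₁ := d) (R₂ := 1)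
    (fun y hy => (hG y (hdD hy)).differentiableAt.differentiableWithinAt)
    (fun y hy => by
      rw [diskAut_self]
      simpa using (norm_diskAut_lt_one hFz (hlt y (hdD hy))).le) hd
  refine le_trans (le_of_eq ?_) hle
  rw [(hG z hz).deriv, mul_one, norm_mul, h2, norm_div, norm_pow, Complex.norm_of_nonneg h1.le]
  field_simp

theorem norm_deriv_le_hyperbolicMetric {D : Set ℂ} (hDo : IsOpen D) {z : ℂ} (hz : z ∈ D)
    {F : ℂ → ℂ} (hF : DifferentiableOn ℂ F D) (hmaps : MapsTo F D (ball 0 1)) (hF0 : F z = 0) :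
    ‖deriv F z‖ ≤ hyperbolicMetric D z 1 :=
  le_csSup (bddAbove_hyperbolicMetric hDo hz) ⟨F, hF, hmaps, by simp [hF0]⟩

theorem one_le_four_mul_hyperbolicMetric {D : Set ℂ} (hDo : IsOpen D) (hDs : IsSimplyConnected D)
    {z w : ℂ} (hz : z ∈ D) (hw : w ∉ D) : 1 ≤ 4 * hyperbolicMetric D z 1 * ‖z - w‖ := by
  refine le_of_forall_lt_imp_le_of_dense fun ρ hρ => ?_
  -- The maximum keeps the covering radius positive.
  suffices h : max ρ (1 / 2) ≤ 4 * hyperbolicMetric D z 1 * ‖z - w‖ from (le_max_left _ _).trans h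
  obtain ⟨F, hF, hF0, hcov⟩ := exists_univalentToDisk_ball_subset hDo hDs hz
    (fun h => hw (h ▸ mem_univ w)) (ρ := max ρ (1 / 2)) (max_lt hρ (by norm_num))
  refine (hF.radius_le hDo hDs hz hF0 (lt_max_of_lt_right (by norm_num)) hcov hw).trans ?_
  have := norm_deriv_le_hyperbolicMetric hDo hz
    (fun y hy => (hF.differentiableAt y hy).differentiableWithinAt)
    (fun y hy => by simpa using hF.mapsTo y hy) hF0
  gcongr

theorem one_le_two_mul_hyperbolicMetric {D : Set ℂ} (hDo : IsOpen D) (hDc : Convex ℝ D)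
    {z w : ℂ} (hz : z ∈ D) (hw : w ∉ D) : 1 ≤ 2 * hyperbolicMetric D z 1 * ‖z - w‖ := by
  obtain ⟨φ, hφ⟩ := geometric_hahn_banach_open_point hDc hDo hw
  -- The separating real functional is `v ↦ Re (c * v)`, so `y ↦ c * (w - y)` sends `D` into the
  -- right half-plane.
  set c : ℂ := ⟨φ 1, -φ Complex.I⟩ with hc
  have hφc : ∀ v, φ v = (c * v).re := fun v => by
    have hv : v = v.re • (1 : ℂ) + v.im • Complex.I := by
      apply Complex.ext <;> simp
    conv_lhs => rw [hv]
    rw [map_add, map_smul, map_smul]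
    simp [hc]
    ring
  have hpos : ∀ y ∈ D, 0 < (c * (w - y)).re := fun y hy => by
    rw [← hφc, map_sub]; exact sub_pos.2 (hφ y hy)
  set u : ℂ → ℂ := fun y => c * (w - y) with hu
  have hne : ∀ y ∈ D, u y + conj (u z) ≠ 0 := fun y hy h => by
    have h1 := congrArg Complex.re h
    rw [Complex.add_re, Complex.conj_re, Complex.zero_re] at h1
    linarith [hpos y hy, hpos z hz]
  have hud : ∀ y, HasDerivAt u (-c) y := fun y => by
    simpa using ((hasDerivAt_id y).const_sub w).const_mul c
  have hFd : ∀ y ∈ D, HasDerivAt (fun y => (u y - u z) / (u y + conj (u z)))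
      ((-c * (u y + conj (u z)) - (u y - u z) * -c) / (u y + conj (u z)) ^ 2) y := fun y hy =>
    ((hud y).sub_const _).fun_div ((hud y).add_const _) (hne y hy)
  -- The test function is the Cayley map of the half-plane centred at `u z`.
  have hle := norm_deriv_le_hyperbolicMetric hDo hz
    (F := fun y => (u y - u z) / (u y + conj (u z)))
    (fun y hy => (hFd y hy).differentiableAt.differentiableWithinAt)
    (fun y hy => by
      rw [mem_ball_zero_iff, norm_div, div_lt_one (norm_pos_iff.2 (hne y hy))]
      refine lt_of_pow_lt_pow_left₀ 2 (norm_nonneg _) ?_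
      have h1 := mul_pos (hpos y hy) (hpos z hz)
      change 0 < (u y).re * (u z).re at h1
      simp only [← Complex.normSq_eq_norm_sq, Complex.normSq_apply, Complex.sub_re, Complex.sub_im,
        Complex.add_re, Complex.add_im, Complex.conj_re, Complex.conj_im]
      nlinarith) (by simp)
  have hre := hpos z hz
  change 0 < (u z).re at hre
  have hval : ‖deriv (fun y => (u y - u z) / (u y + conj (u z))) z‖ = ‖c‖ / (2 * (u z).re) := by
    have h2 : u z + conj (u z) = ((2 * (u z).re : ℝ) : ℂ) := Complex.add_conj _
    have h3 := hne z hz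
    rw [(hFd z hz).deriv, sub_self, zero_mul, sub_zero, pow_two, mul_div_mul_right _ _ h3, norm_div,
      norm_neg, h2, Complex.norm_of_nonneg (by positivity)]
  rw [hval] at hle
  have hcz : (u z).re ≤ ‖c‖ * ‖z - w‖ := by
    refine (Complex.re_le_norm _).trans_eq ?_
    rw [hu]
    simp only [norm_mul, norm_sub_rev z w]
  calc (1 : ℝ) = (u z).re / (u z).re := (div_self hre.ne').symm
    _ ≤ ‖c‖ * ‖z - w‖ / (u z).re := by gcongr
    _ = 2 * (‖c‖ / (2 * (u z).re)) * ‖z - w‖ := by field_simp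
    _ ≤ 2 * hyperbolicMetric D z 1 * ‖z - w‖ := by gcongr

theorem div_distToCompl_le {D : Set ℂ} {z : ℂ} {k γ : ℝ} (hk : 0 < k) (hD : D ≠ univ)
    (h : ∀ w ∉ D, 1 ≤ k * γ * ‖z - w‖) : 1 / k / distToCompl D z ≤ γ := by
  obtain ⟨w₀, hw₀⟩ := (ne_univ_iff_exists_notMem D).1 hD
  -- Positivity here makes the distance to the complement positive, so the final division is
  -- legitimate.
  have hkγ : 0 < k * γ := by
    by_contra! h'
    linarith [h w₀ hw₀, mul_nonpos_of_nonpos_of_nonneg h' (norm_nonneg (z - w₀))]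
  have hδ : 1 / (k * γ) ≤ distToCompl D z := by
    refine le_csInf ⟨_, w₀, hw₀, rfl⟩ ?_
    rintro _ ⟨w, hw, rfl⟩
    rw [div_le_iff₀' hkγ]
    exact h w hw
  have hδ0 : 0 < distToCompl D z := (by positivity : (0 : ℝ) < 1 / (k * γ)).trans_le hδ
  rw [div_le_iff₀' hkγ] at hδ
  rw [div_div, div_le_iff₀ (by positivity)]
  linarith

theorem mainTheorem6 (D : Set ℂ) (hDopen : IsOpen D) (hDsc : IsSimplyConnected D)
    (hDne : D ≠ Set.univ) (z₀ : ℂ) (hz₀ : z₀ ∈ D) :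
    hyperbolicMetric D z₀ 1 ≥ (1 / 4) / distToCompl D z₀ ∧
      (Convex ℝ D → hyperbolicMetric D z₀ 1 ≥ (1 / 2) / distToCompl D z₀) :=
  ⟨div_distToCompl_le (by norm_num) hDne fun _ hw =>
      one_le_four_mul_hyperbolicMetric hDopen hDsc hz₀ hw,
    fun hc => div_distToCompl_le (by norm_num) hDne fun _ hw =>
      one_le_two_mul_hyperbolicMetric hDopen hc hz₀ hw⟩
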